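/- Let $a>0$. Put $\mathbb Z_a=\{\frac{2\pi}{a}k:\ k\in\mathbb Z\}$ and $\mu_a=\frac{2\pi}{a}\sum_{x\in\mathbb Z_a}\delta_x$. For a function $f:\mathbb Z_a\to\mathbb C$, an interval $I$ and an integer $n\ge 0$ let $$\operatorname{osc}(f,I,\mu_a,n)=\inf_{P}\frac1{\mu_a(I)}\int_I|f-P|\,d\mu_a,$$ the infimum being over all complex polynomials $P$ of degree at most $n$. For $p>0$ let $B_p(a,\mathrm{osc})$ be the set of all $f$ with $$\sum_{j\ge 0,\ k\in\mathbb Z}\operatorname{osc}\bigl(f,I_{a,j,k},\mu_a,[\tfrac1p]\bigr)^p<\infty,\qquad I_{a,j,k}=\bigl[\tfrac{2\pi}{a}k2^j,\tfrac{2\pi}{a}(k+1)2^j\bigr].$$ For $\psi:\mathbb Z_a\to\mathbb C$ the discrete Hilbert transform commutator $C_\psi$ is defined on finitely supported functions $f$ by $$(C_\psi f)(x)=\frac1\pi\int_{\mathbb Z_a\setminus\{x\}}\frac{\psi(x)-\psi(t)}{x-t}f(t)\,d\mu_a(t),\qquad x\in\mathbb Z_a,$$ and $C_\psi\in S^p(L^2(\mu_a))$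 means that $C_\psi$ extends to a bounded operator on $L^2(\mu_a)$ whose singular numbers $s_n$ satisfy $\sum_n s_n^p<\infty$. **Proposition.** For every $0<p<1$ and every $a>0$ there is a bounded function $\psi\in B_p(a,\mathrm{osc})$ on $\mathbb Z_a$ such that $C_\psi$ is bounded on $L^2(\mu_a)$ but $C_\psi\notin S^p(L^2(\mu_a))$. Consequently, for every $0<p<1$ and $a>0$, the equivalence "$C_\psi\in S^p(L^2(\mu_a))$ if and only if $\psi\in B_p(a,\mathrm{osc})$" (Rochberg's question) fails, even among bounded functions $\psi$ on $\mathbb Z_a$. -/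

import Mathlib

open MeasureTheory
open scoped ENNReal

noncomputable section

/-- The lattice `ℤ_a = {(2π/a) k : k ∈ ℤ}`. -/
def latticeZ (a : ℝ) : Set ℝ :=
  Set.range fun k : ℤ => 2 * Real.pi / a * (k : ℝ)

/-- The normalized counting measure `μ_a = (2π/a) ∑_{x ∈ ℤ_a} δ_x` on the lattice `ℤ_a`. -/
def latticeMeasure (a : ℝ) : Measure ℝ :=
  ENNReal.ofReal (2 * Real.pi / a) •
    Measure.sum fun k : ℤ => Measure.dirac (2 * Real.pi / a * (k : ℝ))

/-- The interval `I_{a,j,k} = [(2π/a) k 2^j, (2π/a) (k+1) 2^j]`. -/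
def dyadicInterval (a : ℝ) (j : ℕ) (k : ℤ) : Set ℝ :=
  Set.Icc (2 * Real.pi / a * (k : ℝ) * 2 ^ j) (2 * Real.pi / a * ((k : ℝ) + 1) * 2 ^ j)

open scoped Classical in
/-- The oscillation of order `n` of `f` on `I` with respect to `μ`: the infimum, over all complex
polynomials `P` of degree at most `n`, of the `μ`-average of `|f - P|` over `I`; it is `0` if
`μ I = 0`. -/
def meanOscillation (f : ℝ → ℂ) (I : Set ℝ) (μ : Measure ℝ) (n : ℕ) : ℝ≥0∞ :=
  if μ I = 0 then 0
  else ⨅ P : {P : Polynomial ℂ // P.natDegree ≤ n},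
    (∫⁻ x in I, ‖f x - P.1.eval (x : ℂ)‖ₑ ∂μ) / μ I

/-- `f` belongs to the discrete oscillation Besov space `B_p(a, osc)`: it is in `L¹_loc(μ_a)` and
`∑_I osc(f, I, μ_a, [1/p])^p < ∞`, the sum being over all intervals `I_{a,j,k}`, `j ≥ 0`. -/
def MemOscBesov (p a : ℝ) (f : ℝ → ℂ) : Prop :=
  LocallyIntegrable f (latticeMeasure a) ∧
    ∑' jk : ℕ × ℤ,
      meanOscillation f (dyadicInterval a jk.1 jk.2) (latticeMeasure a) ⌊1 / p⌋₊ ^ p < ∞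

/-- The `n`-th singular number (`n = 0, 1, 2, …`) of a bounded operator `T` between Hilbert spaces:
the distance in operator norm from `T` to the operators of rank at most `n`. -/
def singularNumber {H K : Type*} [NormedAddCommGroup H] [InnerProductSpace ℂ H]
    [NormedAddCommGroup K] [InnerProductSpace ℂ K] (T : H →L[ℂ] K) (n : ℕ) : ℝ≥0∞ :=
  ⨅ F : {F : H →L[ℂ] K // F.toLinearMap.rank ≤ (n : Cardinal)}, ‖T - F.1‖ₑ

/-- The Schatten class `S^p`, `0 < p < ∞`: the singular numbers are `p`-summable. -/
def MemSchatten (p : ℝ) {H K : Type*} [NormedAddCommGroup H] [InnerProductSpace ℂ H]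
    [NormedAddCommGroup K] [InnerProductSpace ℂ K] (T : H →L[ℂ] K) : Prop :=
  ∑' n : ℕ, singularNumber T n ^ p < ∞

/-- The Hilbert space `L²(μ_a)`. -/
abbrev LatticeL2 (a : ℝ) : Type := Lp ℂ 2 (latticeMeasure a)

/-- The discrete Hilbert transform commutator, as an integral:
`(C_ψ f)(x) = (1/π) ∫_{t ≠ x} (ψ(x) - ψ(t)) / (x - t) f(t) dμ_a(t)`. -/
def commutatorIntegral (a : ℝ) (ψ f : ℝ → ℂ) (x : ℝ) : ℂ :=
  (1 / (Real.pi : ℂ)) *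
    ∫ t in {x}ᶜ, (ψ x - ψ t) / ((x : ℂ) - (t : ℂ)) * f t ∂(latticeMeasure a)

/-- The bounded operator `T` on `L²(μ_a)` is the operator `C_ψ`: it is given by the commutator
integral on the dense subspace of finitely supported functions. -/
def IsCommutatorOperator (a : ℝ) (ψ : ℝ → ℂ) (T : LatticeL2 a →L[ℂ] LatticeL2 a) : Prop :=
  ∀ f : LatticeL2 a,
    (∃ s : Finset ℝ, ∀ᵐ x ∂(latticeMeasure a), x ∉ s → f x = 0) →
      T f =ᵐ[latticeMeasure a] commutatorIntegral a ψ f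

/-- `C_ψ ∈ S^p(L²(μ_a))`: the operator `C_ψ` extends to a bounded operator on `L²(μ_a)`, and this
operator is in `S^p`. -/
def CommutatorMemSchatten (p a : ℝ) (ψ : ℝ → ℂ) : Prop :=
  ∃ T : LatticeL2 a →L[ℂ] LatticeL2 a, IsCommutatorOperator a ψ T ∧ MemSchatten p T

/-- `ψ` is bounded on the lattice `ℤ_a`. -/
def BoundedOnLattice (a : ℝ) (ψ : ℝ → ℂ) : Prop :=
  ∃ M : ℝ, ∀ x ∈ latticeZ a, ‖ψ x‖ ≤ M

end

/-!
The symbol is the step function `ψ = 1_{[0, ∞)}`. No dyadic interval contains `0` in its interior, so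
`ψ` is constant on all the intervals `I_{a,j,k}` except those with right endpoint `0`, that is
`k = -1`. On `I_{a,j,-1}` it vanishes at all lattice points but one, among more than `2^j`, so
its mean oscillation there is at most `2^{-j}`, which is `p`-summable over `j` for every `p > 0`
(`memOscBesov_stepFun`). Thus the dyadic oscillation condition does not see a jump at `0`.

The commutator does see it. In the coordinates `m ≥ 0` and `-(i + 1) < 0` of the lattice, `C_ψ` is
`1/π` times the Hilbert matrix `1/(m + i + 1)`, coupling the two halves of the lattice in both
directions. It is bounded by the Schur test with weight `1/√(i + 1)`
(`exists_isCommutatorOperator_stepFun`), but it is not compact: `C_ψ` maps the indicator of the block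
of points `-(2π/a) n`, `2^k ≤ n < 2^(k+1)`, to a function that is at least `1/(4π)` on the mirror
image of this block. The normalized block indicators are orthonormal, and finite-rank operators map
an orthonormal sequence to a null sequence, so all singular numbers of `C_ψ` are at least `1/(4π)`
(`le_singularNumber_of_orthonormal`, `not_commutatorMemSchatten_stepFun`).
-/

open Filter Topology

/-! ### Integration over the lattice -/

/-- The point `(2π/a) k` of the lattice `ℤ_a`. -/
noncomputable def latticePoint (a : ℝ) (k : ℤ) : ℝ := 2 * Real.pi / a * (k : ℝ)

lemma latticeSpacing_pos {a : ℝ} (ha : 0 < a) : 0 < 2 * Real.pi / a := by positivity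

lemma latticePoint_nonneg_iff {a : ℝ} (ha : 0 < a) {k : ℤ} : 0 ≤ latticePoint a k ↔ 0 ≤ k := by
  rw [latticePoint, mul_nonneg_iff_of_pos_left (latticeSpacing_pos ha), Int.cast_nonneg_iff]

lemma latticePoint_injective {a : ℝ} (ha : 0 < a) : Function.Injective (latticePoint a) := by
  intro k l h
  exact_mod_cast mul_left_cancel₀ (latticeSpacing_pos ha).ne' h

lemma lintegral_latticeMeasure (a : ℝ) (f : ℝ → ℝ≥0∞) :
    ∫⁻ x, f x ∂latticeMeasure a
      = ENNReal.ofReal (2 * Real.pi / a) * ∑' k, f (latticePoint a k) := by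
  simp [latticeMeasure, lintegral_sum_measure, latticePoint]

lemma latticeMeasure_apply (a : ℝ) {s : Set ℝ} (hs : MeasurableSet s) :
    latticeMeasure a s
      = ENNReal.ofReal (2 * Real.pi / a) * ∑' k, s.indicator 1 (latticePoint a k) := by
  rw [← lintegral_indicator_one hs, lintegral_latticeMeasure]

lemma ae_latticeMeasure_iff {a : ℝ} (ha : 0 < a) {P : ℝ → Prop} :
    (∀ᵐ x ∂latticeMeasure a, P x) ↔ ∀ k, P (latticePoint a k) := by
  have h : ENNReal.ofReal (2 * Real.pi / a) ≠ 0 := by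
    simpa using latticeSpacing_pos ha
  rw [latticeMeasure, Measure.ae_ennreal_smul_measure_iff h, Measure.ae_sum_eq, eventually_iSup]
  simp [ae_dirac_eq, latticePoint]

lemma aestronglyMeasurable_latticeMeasure (a : ℝ) (f : ℝ → ℂ) :
    AEStronglyMeasurable f (latticeMeasure a) :=
  (AEStronglyMeasurable.sum_measure fun _ => aestronglyMeasurable_dirac).smul_measure _

lemma latticeMeasure_image {a : ℝ} (ha : 0 < a) (s : Finset ℤ) :
    latticeMeasure a (s.image (latticePoint a))
      = ENNReal.ofReal (2 * Real.pi / a) * s.card := by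
  rw [latticeMeasure_apply a (Finset.measurableSet _), tsum_eq_sum (s := s)]
  · rw [Finset.sum_congr rfl (g := fun _ => 1)]
    · simp
    · intro k hk
      rw [Set.indicator_of_mem (by simpa using ⟨k, hk, rfl⟩)]
      rfl
  · intro k hk
    refine Set.indicator_of_notMem ?_ _
    simpa [(latticePoint_injective ha).eq_iff] using hk

lemma isLocallyFiniteMeasure_latticeMeasure {a : ℝ} (ha : 0 < a) :
    IsLocallyFiniteMeasure (latticeMeasure a) := by
  have hδ := latticeSpacing_pos ha
  refine ⟨fun x => ⟨Set.Ioo (x - 1) (x + 1), Ioo_mem_nhds (by linarith) (by linarith), ?_⟩⟩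
  -- The lattice points in a bounded interval lie in the image of a finite set of integers.
  let s : Finset ℤ := Finset.Icc ⌊(x - 1) / (2 * Real.pi / a)⌋ ⌈(x + 1) / (2 * Real.pi / a)⌉
  refine lt_of_le_of_lt (b := latticeMeasure a (s.image (latticePoint a))) ?_ ?_
  · refine measure_mono_ae ((ae_latticeMeasure_iff ha).2 fun k hk => ?_)
    suffices h : k ∈ s from Finset.mem_coe.2 (Finset.mem_image_of_mem _ h)
    refine Finset.mem_Icc.2 ⟨?_, ?_⟩
    · refine Int.floor_le_iff.2 ?_
      have : (x - 1) / (2 * Real.pi / a) < k := by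
        rw [div_lt_iff₀ hδ, mul_comm]; exact hk.1
      linarith
    · refine Int.le_ceil_iff.2 ?_
      have : (k : ℝ) < (x + 1) / (2 * Real.pi / a) := by
        rw [lt_div_iff₀ hδ, mul_comm]; exact hk.2
      linarith
  · rw [latticeMeasure_image ha]
    exact ENNReal.mul_lt_top ENNReal.ofReal_lt_top (ENNReal.natCast_lt_top _)

/-! ### The step function has finite oscillation norm -/

/-- The step function `1_{[0, ∞)}`. -/
noncomputable def stepFun : ℝ → ℂ := (Set.Ici 0).indicator 1

lemma stepFun_of_nonneg {x : ℝ} (hx : 0 ≤ x) : stepFun x = 1 :=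
  Set.indicator_of_mem (Set.mem_Ici.2 hx) _

lemma stepFun_of_neg {x : ℝ} (hx : x < 0) : stepFun x = 0 :=
  Set.indicator_of_notMem (fun h => absurd hx (not_lt.2 h)) _

lemma norm_stepFun_le_one (x : ℝ) : ‖stepFun x‖ ≤ 1 := by
  rcases le_or_gt 0 x with hx | hx
  · simp [stepFun_of_nonneg hx]
  · simp [stepFun_of_neg hx]

lemma locallyIntegrable_stepFun {a : ℝ} (ha : 0 < a) :
    LocallyIntegrable stepFun (latticeMeasure a) := by
  have := isLocallyFiniteMeasure_latticeMeasure ha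
  exact (locallyIntegrable_const (1 : ℝ)).mono (aestronglyMeasurable_latticeMeasure a _)
    (ae_of_all _ fun x => by simpa using norm_stepFun_le_one x)

lemma meanOscillation_le (f : ℝ → ℂ) (I : Set ℝ) (μ : Measure ℝ) (n : ℕ) (c : ℂ) :
    meanOscillation f I μ n ≤ (∫⁻ x in I, ‖f x - c‖ₑ ∂μ) / μ I := by
  rw [meanOscillation]
  split_ifs
  · exact zero_le
  · exact iInf_le_of_le ⟨Polynomial.C c, by simp⟩ (by simp)

lemma meanOscillation_eq_zero_of_eqOn {f : ℝ → ℂ} {I : Set ℝ} (hI : MeasurableSet I)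
    {μ : Measure ℝ} {n : ℕ} {c : ℂ} (h : ∀ x ∈ I, f x = c) : meanOscillation f I μ n = 0 := by
  refine le_antisymm ((meanOscillation_le f I μ n c).trans ?_) zero_le
  rw [setLIntegral_congr_fun (g := fun _ => 0) hI fun x hx => by simp [h x hx]]
  simp

lemma measurableSet_dyadicInterval (a : ℝ) (j : ℕ) (k : ℤ) : MeasurableSet (dyadicInterval a j k) :=
  measurableSet_Icc

lemma meanOscillation_stepFun_of_ne {a : ℝ} (ha : 0 < a) (j n : ℕ) {k : ℤ} (hk : k ≠ -1) :
    meanOscillation stepFun (dyadicInterval a j k) (latticeMeasure a) n = 0 := by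
  have hδ := latticeSpacing_pos ha
  rcases lt_or_ge k 0 with h | h
  · refine meanOscillation_eq_zero_of_eqOn (measurableSet_dyadicInterval a j k) (c := 0) fun x hx => ?_
    refine stepFun_of_neg (hx.2.trans_lt ?_)
    have : (k : ℝ) + 1 < 0 := by exact_mod_cast (by omega : k + 1 < 0)
    exact mul_neg_of_neg_of_pos (mul_neg_of_pos_of_neg hδ this) (by positivity)
  · refine meanOscillation_eq_zero_of_eqOn (measurableSet_dyadicInterval a j k) (c := 1) fun x hx => ?_
    have : (0 : ℝ) ≤ k := by exact_mod_cast h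
    exact stepFun_of_nonneg (le_trans (by positivity) hx.1)

/-- The interval `[-(2π/a) 2^j, 0]` carries more than `2^j` lattice points, and the step function
differs from `0` at only one of them. -/
lemma meanOscillation_stepFun_neg_one_le {a : ℝ} (ha : 0 < a) (j n : ℕ) :
    meanOscillation stepFun (dyadicInterval a j (-1)) (latticeMeasure a) n ≤ 2⁻¹ ^ j := by
  have hδ := latticeSpacing_pos ha
  have hδ' : ENNReal.ofReal (2 * Real.pi / a) ≠ 0 := by simpa using hδ
  refine (meanOscillation_le _ _ _ n 0).trans ?_
  have h1 : ∫⁻ x in dyadicInterval a j (-1), ‖stepFun x - 0‖ₑ ∂latticeMeasure a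
      ≤ ENNReal.ofReal (2 * Real.pi / a) := by
    rw [← lintegral_indicator (measurableSet_dyadicInterval a j (-1)),
      lintegral_latticeMeasure, tsum_eq_single 0]
    · refine mul_le_of_le_one_right zero_le ((Set.indicator_le_self _ _ _).trans ?_)
      rw [sub_zero, ← ofReal_norm]
      exact ENNReal.ofReal_le_one.2 (norm_stepFun_le_one _)
    · intro k hk
      rcases lt_or_gt_of_ne hk with h | h
      · rw [Set.indicator_apply_eq_zero]
        intro _
        rw [stepFun_of_neg (not_le.1 fun h' => absurd h (not_lt.2 ((latticePoint_nonneg_iff ha).1 h')))]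
        simp
      · refine Set.indicator_of_notMem (fun hx => ?_) _
        have h2 := hx.2
        have : 0 < latticePoint a k := mul_pos hδ (by exact_mod_cast h)
        simp at h2
        linarith
  have h2 : ENNReal.ofReal (2 * Real.pi / a) * 2 ^ j
      ≤ latticeMeasure a (dyadicInterval a j (-1)) := by
    refine le_trans (le_of_eq ?_) (measure_mono (s := ↑((Finset.Ico (-2 ^ j : ℤ) 0).image
      (latticePoint a))) ?_)
    · have h : ((0 : ℤ) - -2 ^ j).toNat = 2 ^ j := by
        rw [show (0 : ℤ) - -2 ^ j = ((2 ^ j : ℕ) : ℤ) by simp, Int.toNat_natCast]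
      rw [latticeMeasure_image ha, Int.card_Ico, h]
      simp
    · intro x hx
      obtain ⟨k, hk, rfl⟩ := Finset.mem_image.1 (Finset.mem_coe.1 hx)
      rw [Finset.mem_Ico] at hk
      have hk1 : -(2 : ℝ) ^ j ≤ k := by exact_mod_cast hk.1
      have hk2 : (k : ℝ) ≤ 0 := by exact_mod_cast hk.2.le
      refine ⟨?_, ?_⟩
      · have := mul_le_mul_of_nonneg_left hk1 hδ.le
        simpa [latticePoint] using this
      · have := mul_nonpos_of_nonneg_of_nonpos hδ.le hk2
        simpa [latticePoint] using this
  refine (ENNReal.div_le_div h1 h2).trans (le_of_eq ?_)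
  rw [ENNReal.div_eq_inv_mul, ENNReal.mul_inv (.inl hδ') (.inl ENNReal.ofReal_ne_top), mul_right_comm,
    ENNReal.inv_mul_cancel hδ' ENNReal.ofReal_ne_top, one_mul, ENNReal.inv_pow]

lemma memOscBesov_stepFun {p a : ℝ} (hp : 0 < p) (ha : 0 < a) : MemOscBesov p a stepFun := by
  refine ⟨locallyIntegrable_stepFun ha, ?_⟩
  rw [ENNReal.tsum_prod (f := fun j k =>
    meanOscillation stepFun (dyadicInterval a j k) (latticeMeasure a) ⌊1 / p⌋₊ ^ p)]
  refine lt_of_le_of_lt (b := ∑' j : ℕ, ((2⁻¹ : ℝ≥0∞) ^ p) ^ j) (ENNReal.tsum_le_tsum fun j => ?_) ?_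
  · rw [tsum_eq_single (-1)]
    · refine (ENNReal.rpow_le_rpow (meanOscillation_stepFun_neg_one_le ha j _) hp.le).trans ?_
      rw [← ENNReal.rpow_natCast, ← ENNReal.rpow_natCast, ← ENNReal.rpow_mul, ← ENNReal.rpow_mul,
        mul_comm]
    · intro k hk
      simp [meanOscillation_stepFun_of_ne ha j _ hk, hp]
  · rw [ENNReal.tsum_geometric, ENNReal.inv_lt_top, tsub_pos_iff_lt]
    exact ENNReal.rpow_lt_one (by simp) hp

/-! ### The Schur test -/

/-- The Cauchy–Schwarz inequality for sums in `[0, ∞]`, for a sequence `c` given as the termwise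
geometric mean of `u` and `v`. -/
lemma ENNReal.sq_tsum_le_tsum_mul_tsum {ι : Type*} {c u v : ι → ℝ≥0∞}
    (h : ∀ i, c i ^ 2 = u i * v i) : (∑' i, c i) ^ 2 ≤ (∑' i, u i) * ∑' i, v i := by
  let _ : MeasurableSpace ι := ⊤
  have hc : ∀ i, c i = ((fun i => u i ^ (1 / 2 : ℝ)) * fun i => v i ^ (1 / 2 : ℝ)) i := fun i => by
    rw [Pi.mul_apply, ← ENNReal.mul_rpow_of_nonneg _ _ (by norm_num), ← h, ← ENNReal.rpow_natCast,
      ← ENNReal.rpow_mul]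
    norm_num
  have key := ENNReal.lintegral_mul_le_Lp_mul_Lq (Measure.count : Measure ι)
    Real.HolderConjugate.two_two (f := fun i => u i ^ (1 / 2 : ℝ))
    (g := fun i => v i ^ (1 / 2 : ℝ)) measurable_from_top.aemeasurable
    measurable_from_top.aemeasurable
  simp only [← hc, lintegral_count, ← ENNReal.rpow_mul] at key
  rw [← ENNReal.mul_rpow_of_nonneg _ _ (by norm_num)] at key
  have := ENNReal.rpow_le_rpow key (by norm_num : (0 : ℝ) ≤ 2)
  rw [← ENNReal.rpow_mul] at this
  norm_num at this
  exact this

/-- The Schur test, for a symmetric nonnegative matrix `k` with positive finite weight `w`. -/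
lemma tsum_sq_tsum_mul_le_of_schur {ι : Type*} {k : ι → ι → ℝ≥0∞} (hk : ∀ m n, k m n = k n m)
    {w : ι → ℝ≥0∞} (hw0 : ∀ n, w n ≠ 0) (hw : ∀ n, w n ≠ ∞) {C : ℝ≥0∞}
    (hC : ∀ m, ∑' n, k m n * w n ≤ C * w m) (f : ι → ℝ≥0∞) :
    ∑' m, (∑' n, k m n * f n) ^ 2 ≤ C ^ 2 * ∑' n, f n ^ 2 := by
  calc ∑' m, (∑' n, k m n * f n) ^ 2
      ≤ ∑' m, C * w m * ∑' n, k m n * f n ^ 2 * (w n)⁻¹ := by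
        refine ENNReal.tsum_le_tsum fun m => ?_
        refine (ENNReal.sq_tsum_le_tsum_mul_tsum fun n => ?_).trans (mul_le_mul_left (hC m) _)
        calc (k m n * f n) ^ 2 = k m n ^ 2 * f n ^ 2 * (w n * (w n)⁻¹) := by
              rw [ENNReal.mul_inv_cancel (hw0 n) (hw n)]; ring
          _ = _ := by ring
    _ = ∑' n, C * (f n ^ 2 * (w n)⁻¹) * ∑' m, k n m * w m := by
        simp only [← ENNReal.tsum_mul_left]
        rw [ENNReal.tsum_comm]
        refine tsum_congr fun n => tsum_congr fun m => ?_
        rw [hk m n]; ring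
    _ ≤ ∑' n, C * (f n ^ 2 * (w n)⁻¹) * (C * w n) :=
        ENNReal.tsum_le_tsum fun n => mul_le_mul_right (hC n) _
    _ = C ^ 2 * ∑' n, f n ^ 2 := by
        rw [← ENNReal.tsum_mul_left]
        refine tsum_congr fun n => ?_
        calc C * (f n ^ 2 * (w n)⁻¹) * (C * w n) = C ^ 2 * f n ^ 2 * (w n * (w n)⁻¹) := by ring
          _ = _ := by rw [ENNReal.mul_inv_cancel (hw0 n) (hw n), mul_one]

/-! ### The commutator of the step function is bounded -/

/-- With `s = √(m+1)`, the terms of the Schur sum of the Hilbert matrix are dominated by the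
increments of `-8 / (s + √i)`. -/
lemma hilbert_schur_term_le (m i : ℕ) :
    1 / ((m : ℝ) + i + 1) * (1 / √((i : ℝ) + 1))
      ≤ 8 * (1 / (√((m : ℝ) + 1) + √i) - 1 / (√((m : ℝ) + 1) + √((i : ℝ) + 1))) := by
  have hm : (0 : ℝ) ≤ m := m.cast_nonneg
  have hi : (0 : ℝ) ≤ i := i.cast_nonneg
  set s := √((m : ℝ) + 1) with hs
  set u := √((i : ℝ) + 1) with hu
  set v := √(i : ℝ) with hv
  have hs2 : s ^ 2 = m + 1 := Real.sq_sqrt (by positivity)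
  have hu2 : u ^ 2 = i + 1 := Real.sq_sqrt (by positivity)
  have hv2 : v ^ 2 = i := Real.sq_sqrt hi
  have hs0 : 0 < s := Real.sqrt_pos.2 (by positivity)
  have hu0 : 0 < u := Real.sqrt_pos.2 (by positivity)
  have hv0 : 0 ≤ v := Real.sqrt_nonneg _
  have hvu : v ≤ u := Real.sqrt_le_sqrt (by linarith)
  have hdiff : 1 / (s + v) - 1 / (s + u) = 1 / ((s + v) * (s + u) * (u + v)) := by
    have : (u - v) * (u + v) = 1 := by nlinarith
    field_simp
    linarith
  rw [hdiff, div_mul_div_comm, one_mul, mul_one_div, div_le_div_iff₀ (by positivity) (by positivity)]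
  have h1 : (s + v) * (s + u) ≤ 4 * (m + i + 1) := by
    have : (s + v) * (s + u) ≤ (s + u) * (s + u) :=
      mul_le_mul_of_nonneg_right (by linarith) (by positivity)
    nlinarith [sq_nonneg (s - u)]
  have h2 : u + v ≤ 2 * u := by linarith
  have h3 := mul_le_mul h1 h2 (by positivity) (by positivity)
  linarith

lemma tsum_hilbert_schur_le (m : ℕ) :
    ∑' i : ℕ, ENNReal.ofReal (1 / ((m : ℝ) + i + 1)) * ENNReal.ofReal (1 / √((i : ℝ) + 1))
      ≤ 8 * ENNReal.ofReal (1 / √((m : ℝ) + 1)) := by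
  refine ENNReal.tsum_le_of_sum_range_le fun n => ?_
  rw [← ENNReal.ofReal_ofNat, ← ENNReal.ofReal_mul (by norm_num)]
  rw [Finset.sum_congr rfl fun (i : ℕ) _ =>
    (ENNReal.ofReal_mul (by positivity : 0 ≤ 1 / ((m : ℝ) + i + 1))).symm,
    ← ENNReal.ofReal_sum_of_nonneg fun i _ => by positivity]
  refine ENNReal.ofReal_le_ofReal ((Finset.sum_le_sum fun i _ => hilbert_schur_term_le m i).trans ?_)
  have h := Finset.sum_range_sub' (fun i : ℕ => 1 / (√((m : ℝ) + 1) + √(i : ℝ))) n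
  push_cast at h
  rw [← Finset.mul_sum, h, Real.sqrt_zero, add_zero]
  have : 0 ≤ 1 / (√((m : ℝ) + 1) + √(n : ℝ)) := by positivity
  linarith

/-- The Hilbert matrix `1 / (m + i + 1)`, coupling the index `m ≥ 0` with the index `-(i+1) < 0`, as
a symmetric matrix on `ℤ`. -/
noncomputable def hilbertKernel : ℤ → ℤ → ℝ≥0∞
  | .ofNat m, .negSucc i => ENNReal.ofReal (1 / ((m : ℝ) + i + 1))
  | .negSucc m, .ofNat i => ENNReal.ofReal (1 / ((m : ℝ) + i + 1))
  | _, _ => 0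

/-- The Schur weight `1 / √(i + 1)` at `i` and at `-(i+1)`. -/
noncomputable def schurWeight : ℤ → ℝ≥0∞
  | .ofNat i => ENNReal.ofReal (1 / √((i : ℝ) + 1))
  | .negSucc i => ENNReal.ofReal (1 / √((i : ℝ) + 1))

lemma hilbertKernel_symm (m n : ℤ) : hilbertKernel m n = hilbertKernel n m := by
  rcases m with m | m <;> rcases n with n | n <;> simp [hilbertKernel, add_comm (m : ℝ)]

lemma tsum_hilbertKernel_mul_schurWeight_le (m : ℤ) :
    ∑' n, hilbertKernel m n * schurWeight n ≤ 8 * schurWeight m := by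
  have hsplit : ∀ g : ℤ → ℝ≥0∞, ∑' n, g n = ∑' i : ℕ, g (.ofNat i) + ∑' i : ℕ, g (.negSucc i) :=
    fun g => by
      simp only [tsum_of_nat_of_neg_add_one ENNReal.summable ENNReal.summable, Int.negSucc_eq,
        Int.ofNat_eq_natCast]
  rw [hsplit]
  rcases m with m | m
  · simp only [hilbertKernel, schurWeight, zero_mul, tsum_zero, zero_add]
    exact tsum_hilbert_schur_le m
  · simp only [hilbertKernel, schurWeight, zero_mul, tsum_zero, add_zero]
    exact tsum_hilbert_schur_le m

lemma tsum_sq_tsum_hilbertKernel_le (f : ℤ → ℝ≥0∞) :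
    ∑' m, (∑' n, hilbertKernel m n * f n) ^ 2 ≤ 8 ^ 2 * ∑' n, f n ^ 2 := by
  refine tsum_sq_tsum_mul_le_of_schur hilbertKernel_symm (w := schurWeight) ?_ ?_
    tsum_hilbertKernel_mul_schurWeight_le f
  · rintro (i | i) <;>
    · simp only [schurWeight, ne_eq, ENNReal.ofReal_eq_zero, not_le]
      positivity
  · rintro (i | i) <;> exact ENNReal.ofReal_ne_top

/-- The factor `2π/a` of the measure cancels the one in the denominator. -/
lemma enorm_stepFun_kernel {a : ℝ} (ha : 0 < a) (m n : ℤ) :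
    ENNReal.ofReal (2 * Real.pi / a) * ‖(stepFun (latticePoint a m) - stepFun (latticePoint a n)) /
      ((latticePoint a m : ℂ) - (latticePoint a n : ℂ))‖ₑ = hilbertKernel m n := by
  have hδ := latticeSpacing_pos ha
  have hpos : ∀ i : ℕ, stepFun (latticePoint a (.ofNat i)) = 1 := fun i =>
    stepFun_of_nonneg ((latticePoint_nonneg_iff ha).2 (Int.natCast_nonneg i))
  have hneg : ∀ i : ℕ, stepFun (latticePoint a (.negSucc i)) = 0 := fun i =>
    stepFun_of_neg (not_le.1 fun h =>
      absurd ((latticePoint_nonneg_iff ha).1 h) (not_le.2 (Int.negSucc_lt_zero i)))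
  have hval : ∀ i j : ℕ, 2 * Real.pi / a * ‖latticePoint a (.ofNat i) - latticePoint a (.negSucc j)‖⁻¹
      = 1 / ((i : ℝ) + j + 1) := fun i j => by
    have : latticePoint a (.ofNat i) - latticePoint a (.negSucc j)
        = 2 * Real.pi / a * ((i : ℝ) + j + 1) := by
      simp only [latticePoint, Int.cast_negSucc, Int.ofNat_eq_natCast, Int.cast_natCast]
      push_cast
      ring
    rw [this, Real.norm_of_nonneg (by positivity), mul_inv, ← mul_assoc, mul_inv_cancel₀ hδ.ne',
      one_mul, one_div]
  rw [← ofReal_norm, ← ENNReal.ofReal_mul hδ.le, norm_div, ← Complex.ofReal_sub, Complex.norm_real]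
  rcases m with m | m <;> rcases n with n | n <;> simp only [hpos, hneg, hilbertKernel]
  · simp
  · rw [sub_zero, norm_one, one_div, hval]
  · rw [zero_sub, norm_neg, norm_one, one_div, norm_sub_rev, hval, add_comm (n : ℝ)]
  · simp

lemma lintegral_enorm_stepFun_kernel {a : ℝ} (ha : 0 < a) (f : ℝ → ℂ) (m : ℤ) :
    ∫⁻ t, ‖(stepFun (latticePoint a m) - stepFun t) / ((latticePoint a m : ℂ) - (t : ℂ)) * f t‖ₑ
      ∂latticeMeasure a = ∑' n, hilbertKernel m n * ‖f (latticePoint a n)‖ₑ := by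
  rw [lintegral_latticeMeasure, ← ENNReal.tsum_mul_left]
  refine tsum_congr fun n => ?_
  rw [enorm_mul, ← mul_assoc, enorm_stepFun_kernel ha]

lemma enorm_commutatorIntegral_stepFun_le {a : ℝ} (ha : 0 < a) (f : ℝ → ℂ) (m : ℤ) :
    ‖commutatorIntegral a stepFun f (latticePoint a m)‖ₑ
      ≤ ∑' n, hilbertKernel m n * ‖f (latticePoint a n)‖ₑ := by
  rw [commutatorIntegral, enorm_mul, ← lintegral_enorm_stepFun_kernel ha]
  have hpi : ‖(1 / (Real.pi : ℂ))‖ₑ ≤ 1 := by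
    rw [← ofReal_norm, ENNReal.ofReal_le_one, norm_div, norm_one,
      Complex.norm_of_nonneg Real.pi_pos.le, div_le_one Real.pi_pos]
    linarith [Real.pi_gt_three]
  refine (mul_le_of_le_one_left zero_le hpi).trans ((enorm_integral_le_lintegral_enorm _).trans ?_)
  exact lintegral_mono' Measure.restrict_le_self le_rfl

lemma eLpNorm_two_sq_latticeMeasure (a : ℝ) (f : ℝ → ℂ) :
    eLpNorm f 2 (latticeMeasure a) ^ 2
      = ENNReal.ofReal (2 * Real.pi / a) * ∑' k, ‖f (latticePoint a k)‖ₑ ^ 2 := by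
  have h := eLpNorm_nnreal_pow_eq_lintegral (f := f) (μ := latticeMeasure a)
    (two_ne_zero : (2 : NNReal) ≠ 0)
  rw [lintegral_latticeMeasure] at h
  simpa using h

lemma eLpNorm_commutatorIntegral_stepFun_le {a : ℝ} (ha : 0 < a) (f : ℝ → ℂ) :
    eLpNorm (commutatorIntegral a stepFun f) 2 (latticeMeasure a)
      ≤ 8 * eLpNorm f 2 (latticeMeasure a) := by
  rw [← ENNReal.pow_le_pow_left_iff two_ne_zero, mul_pow, eLpNorm_two_sq_latticeMeasure,
    eLpNorm_two_sq_latticeMeasure, mul_left_comm]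
  refine mul_le_mul_right (le_trans (ENNReal.tsum_le_tsum fun m => ?_)
    (tsum_sq_tsum_hilbertKernel_le fun n => ‖f (latticePoint a n)‖ₑ)) _
  exact pow_le_pow_left' (enorm_commutatorIntegral_stepFun_le ha f m) 2

lemma memLp_commutatorIntegral_stepFun {a : ℝ} (ha : 0 < a) (f : LatticeL2 a) :
    MemLp (commutatorIntegral a stepFun f) 2 (latticeMeasure a) :=
  ⟨aestronglyMeasurable_latticeMeasure a _, (eLpNorm_commutatorIntegral_stepFun_le ha f).trans_lt
    (ENNReal.mul_lt_top (by simp) (Lp.memLp f).2)⟩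

/-- Each row of the commutator kernel is integrable against `L²(μ_a)`, since the square sum over all
rows in the Schur test is finite. -/
lemma integrableOn_stepFun_kernel_mul {a : ℝ} (ha : 0 < a) (f : LatticeL2 a) (m : ℤ) :
    IntegrableOn (fun t : ℝ => (stepFun (latticePoint a m) - stepFun t) /
      ((latticePoint a m : ℂ) - (t : ℂ)) * f t) {latticePoint a m}ᶜ (latticeMeasure a) := by
  refine Integrable.integrableOn ⟨aestronglyMeasurable_latticeMeasure a _, ?_⟩
  rw [hasFiniteIntegral_iff_enorm, lintegral_enorm_stepFun_kernel ha]
  have hδ : ENNReal.ofReal (2 * Real.pi / a) ≠ 0 := by simpa using latticeSpacing_pos ha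
  have hf : ∑' n, ‖f (latticePoint a n)‖ₑ ^ 2 < ∞ := by
    have h := ENNReal.pow_lt_top (n := 2) (Lp.memLp f).2
    rw [eLpNorm_two_sq_latticeMeasure] at h
    exact ENNReal.lt_top_of_mul_ne_top_right h.ne hδ
  have h := (tsum_sq_tsum_hilbertKernel_le fun n => ‖f (latticePoint a n)‖ₑ).trans_lt
    (ENNReal.mul_lt_top (by simp) hf)
  exact (ENNReal.pow_lt_top_iff.1 ((ENNReal.le_tsum m).trans_lt h)).resolve_right two_ne_zero

lemma commutatorIntegral_stepFun_add {a : ℝ} (ha : 0 < a) (f g : LatticeL2 a) :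
    commutatorIntegral a stepFun (f + g : LatticeL2 a) =ᵐ[latticeMeasure a]
      commutatorIntegral a stepFun f + commutatorIntegral a stepFun g := by
  refine (ae_latticeMeasure_iff ha).2 fun m => ?_
  simp only [commutatorIntegral, Pi.add_apply]
  rw [← mul_add, ← integral_add (integrableOn_stepFun_kernel_mul ha f m)
    (integrableOn_stepFun_kernel_mul ha g m)]
  congr 1
  refine integral_congr_ae (ae_restrict_of_ae ((Lp.coeFn_add f g).mono fun t ht => ?_))
  simp only [ht, Pi.add_apply, mul_add]

lemma commutatorIntegral_smul (a : ℝ) (ψ : ℝ → ℂ) (c : ℂ) (f : LatticeL2 a) :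
    commutatorIntegral a ψ (c • f : LatticeL2 a) = c • commutatorIntegral a ψ f := by
  ext x
  simp only [commutatorIntegral, Pi.smul_apply, smul_eq_mul]
  rw [mul_left_comm c, ← integral_const_mul c]
  congr 1
  refine integral_congr_ae (ae_restrict_of_ae ((Lp.coeFn_smul c f).mono fun t ht => ?_))
  simp only [ht, Pi.smul_apply, smul_eq_mul]
  ring

lemma exists_isCommutatorOperator_stepFun {a : ℝ} (ha : 0 < a) :
    ∃ T : LatticeL2 a →L[ℂ] LatticeL2 a, IsCommutatorOperator a stepFun T := by
  let T₀ : LatticeL2 a →ₗ[ℂ] LatticeL2 a :=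
    { toFun := fun f => (memLp_commutatorIntegral_stepFun ha f).toLp _
      map_add' := fun f g => by
        rw [← MemLp.toLp_add]
        exact MemLp.toLp_congr _ _ (commutatorIntegral_stepFun_add ha f g)
      map_smul' := fun c f => by
        rw [RingHom.id_apply, ← MemLp.toLp_const_smul c (memLp_commutatorIntegral_stepFun ha f)]
        exact MemLp.toLp_congr _ _ (.of_eq (commutatorIntegral_smul a stepFun c f)) }
  refine ⟨T₀.mkContinuous 8 fun f => ?_, fun f _ =>
    MemLp.coeFn_toLp (memLp_commutatorIntegral_stepFun ha f)⟩
  have h := eLpNorm_commutatorIntegral_stepFun_le ha f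
  calc ‖T₀ f‖ = (eLpNorm (commutatorIntegral a stepFun f) 2 (latticeMeasure a)).toReal :=
        Lp.norm_toLp _ (memLp_commutatorIntegral_stepFun ha f)
    _ ≤ (8 * eLpNorm f 2 (latticeMeasure a)).toReal :=
        ENNReal.toReal_mono (ENNReal.mul_ne_top (by simp) (Lp.memLp f).2.ne) h
    _ = 8 * ‖f‖ := by rw [ENNReal.toReal_mul, Lp.norm_def]; simp

/-! ### Operators bounded below on an orthonormal sequence -/

/-- By Bessel's inequality an orthonormal sequence is weakly null, and a finite-rank operator turns
weak convergence into norm convergence. -/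
lemma tendsto_apply_orthonormal_of_rank_le {H K : Type*} [NormedAddCommGroup H]
    [InnerProductSpace ℂ H] [CompleteSpace H] [NormedAddCommGroup K] [InnerProductSpace ℂ K]
    [CompleteSpace K] {F : H →L[ℂ] K} {n : ℕ} (hF : F.toLinearMap.rank ≤ (n : Cardinal))
    {e : ℕ → H} (he : Orthonormal ℂ e) : Tendsto (fun k => F (e k)) atTop (𝓝 0) := by
  have hfin : FiniteDimensional ℂ (LinearMap.range F.toLinearMap) :=
    Module.rank_lt_aleph0_iff.1 (hF.trans_lt Cardinal.natCast_lt_aleph0)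
  let b := stdOrthonormalBasis ℂ (LinearMap.range F.toLinearMap)
  have hsum : ∀ x, ∑ i, inner ℂ (b i : K) (F x) • (b i : K) = F x := by
    intro x
    have h := congrArg (Subtype.val) (b.sum_repr' ⟨F x, LinearMap.mem_range_self _ x⟩)
    simpa using h
  have hlim : ∀ y : H, Tendsto (fun k => inner ℂ y (e k)) atTop (𝓝 0) := by
    intro y
    have h := (he.inner_products_summable y).tendsto_atTop_zero
    rw [tendsto_zero_iff_norm_tendsto_zero]
    have h' := h.sqrt
    simpa [norm_inner_symm y] using h'
  -- The coordinates of `F (e k)` in a basis of the range are `⟪F* bᵢ, e k⟫`, which tend to `0`.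
  have key : Tendsto (fun k => ∑ i, inner ℂ (F.adjoint (b i : K)) (e k) • (b i : K)) atTop
      (𝓝 (∑ i, (0 : ℂ) • (b i : K))) :=
    tendsto_finsetSum _ fun i _ => (hlim _).smul_const _
  simpa [ContinuousLinearMap.adjoint_inner_left, hsum] using key

lemma le_singularNumber_of_orthonormal {H K : Type*} [NormedAddCommGroup H]
    [InnerProductSpace ℂ H] [CompleteSpace H] [NormedAddCommGroup K] [InnerProductSpace ℂ K]
    [CompleteSpace K] {T : H →L[ℂ] K} {e : ℕ → H} (he : Orthonormal ℂ e) {c : ℝ}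
    (hc : ∀ k, c ≤ ‖T (e k)‖) (n : ℕ) : ENNReal.ofReal c ≤ singularNumber T n := by
  refine le_iInf fun F => ?_
  rw [← ofReal_norm]
  refine ENNReal.ofReal_le_ofReal ?_
  have hlim := (tendsto_apply_orthonormal_of_rank_le F.2 he).norm.const_sub c
  rw [norm_zero, sub_zero] at hlim
  refine le_of_tendsto' hlim fun k => ?_
  have h1 := (T - F.1).le_opNorm (e k)
  rw [he.1 k, mul_one, sub_apply] at h1
  have h2 := norm_sub_norm_le (T (e k)) (F.1 (e k))
  linarith [hc k]

lemma not_memSchatten_of_orthonormal {H K : Type*} [NormedAddCommGroup H]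
    [InnerProductSpace ℂ H] [CompleteSpace H] [NormedAddCommGroup K] [InnerProductSpace ℂ K]
    [CompleteSpace K] {T : H →L[ℂ] K} {e : ℕ → H} (he : Orthonormal ℂ e) {c : ℝ} (hc0 : 0 < c)
    (hc : ∀ k, c ≤ ‖T (e k)‖) {p : ℝ} (hp : 0 ≤ p) : ¬ MemSchatten p T := by
  rw [MemSchatten, not_lt, top_le_iff]
  refine top_unique (le_trans (le_of_eq ?_) (ENNReal.tsum_le_tsum fun n =>
    ENNReal.rpow_le_rpow (le_singularNumber_of_orthonormal he hc n) hp))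
  rw [ENNReal.tsum_const_eq_top_of_ne_zero]
  exact (ENNReal.rpow_pos (by simpa using hc0) ENNReal.ofReal_ne_top).ne'

/-! ### The commutator of the step function is not compact -/

/-- The block of lattice points `σ (2π/a) n`, `2^k ≤ n < 2^(k+1)`. The relevant cases are `σ = -1`
and its mirror image `σ = 1`. -/
noncomputable def latticeBlock (a : ℝ) (σ : ℤ) (k : ℕ) : Finset ℝ :=
  ((Finset.Ico (2 ^ k : ℤ) (2 ^ (k + 1))).image (σ * ·)).image (latticePoint a)

lemma latticeMeasure_latticeBlock {a : ℝ} (ha : 0 < a) {σ : ℤ} (hσ : σ ≠ 0) (k : ℕ) :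
    latticeMeasure a (latticeBlock a σ k) = ENNReal.ofReal (2 * Real.pi / a * 2 ^ k) := by
  rw [latticeBlock, latticeMeasure_image ha,
    Finset.card_image_of_injective _ (mul_right_injective₀ hσ), Int.card_Ico,
    ENNReal.ofReal_mul (latticeSpacing_pos ha).le]
  have : ((2 : ℤ) ^ (k + 1) - 2 ^ k).toNat = 2 ^ k := by
    rw [pow_succ]
    have : (2 : ℤ) ^ k * 2 - 2 ^ k = ((2 ^ k : ℕ) : ℤ) := by push_cast; ring
    rw [this, Int.toNat_natCast]
  rw [this, ENNReal.ofReal_pow (by norm_num)]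
  simp

lemma mem_latticeBlock {a : ℝ} {σ : ℤ} {k : ℕ} {x : ℝ} :
    x ∈ latticeBlock a σ k ↔
      ∃ n : ℤ, (2 ^ k ≤ n ∧ n < 2 ^ (k + 1)) ∧ latticePoint a (σ * n) = x := by
  simp [latticeBlock]

lemma disjoint_latticeBlock {a : ℝ} (ha : 0 < a) {σ : ℤ} (hσ : σ ≠ 0) {k l : ℕ} (hkl : k ≠ l) :
    Disjoint (latticeBlock a σ k) (latticeBlock a σ l) := by
  rw [Finset.disjoint_left]
  intro x hk hl
  obtain ⟨m, hm, rfl⟩ := mem_latticeBlock.1 hk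
  obtain ⟨n, hn, h⟩ := mem_latticeBlock.1 hl
  obtain rfl := mul_left_cancel₀ hσ (latticePoint_injective ha h)
  rcases lt_or_gt_of_ne hkl with h | h
  · have := pow_le_pow_right₀ (by norm_num : (1 : ℤ) ≤ 2) h
    exact absurd (hm.2.trans_le this) (not_lt.2 hn.1)
  · have := pow_le_pow_right₀ (by norm_num : (1 : ℤ) ≤ 2) h
    exact absurd (hn.2.trans_le this) (not_lt.2 hm.1)

lemma latticeMeasure_latticeBlock_ne_top {a : ℝ} (ha : 0 < a) {σ : ℤ} (hσ : σ ≠ 0) (k : ℕ) :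
    latticeMeasure a (latticeBlock a σ k) ≠ ∞ := by
  rw [latticeMeasure_latticeBlock ha hσ]
  exact ENNReal.ofReal_ne_top

/-- The indicator function of a block, as an element of `L²(μ_a)`. -/
noncomputable def blockIndicator {a : ℝ} (ha : 0 < a) {σ : ℤ} (hσ : σ ≠ 0) (k : ℕ) (c : ℂ) :
    LatticeL2 a :=
  indicatorConstLp 2 (latticeBlock a σ k).measurableSet
    (latticeMeasure_latticeBlock_ne_top ha hσ k) c

lemma blockIndicator_coeFn {a : ℝ} (ha : 0 < a) {σ : ℤ} (hσ : σ ≠ 0) (k : ℕ) (c : ℂ) :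
    blockIndicator ha hσ k c =ᵐ[latticeMeasure a]
      Set.indicator (latticeBlock a σ k) fun _ => c :=
  indicatorConstLp_coeFn

lemma norm_blockIndicator {a : ℝ} (ha : 0 < a) {σ : ℤ} (hσ : σ ≠ 0) (k : ℕ) (c : ℂ) :
    ‖blockIndicator ha hσ k c‖ = ‖c‖ * √(2 * Real.pi / a * 2 ^ k) := by
  have := latticeSpacing_pos ha
  rw [blockIndicator, norm_indicatorConstLp (by simp) (by simp), Measure.real,
    latticeMeasure_latticeBlock ha hσ, ENNReal.toReal_ofReal (by positivity), Real.sqrt_eq_rpow]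
  simp

/-- The commutator with the step function maps the indicator of the block on the negative side to a
function that is at least `1/(4π)` on its mirror image: there `x - t ≤ 4 · 2^k · 2π/a`. -/
lemma le_norm_commutatorIntegral_block {a : ℝ} (ha : 0 < a) {k : ℕ} {x : ℝ}
    (hx : x ∈ latticeBlock a 1 k) {f : ℝ → ℂ}
    (hf : f =ᵐ[latticeMeasure a] Set.indicator (latticeBlock a (-1) k) fun _ => (1 : ℂ)) :
    1 / (4 * Real.pi) ≤ ‖commutatorIntegral a stepFun f x‖ := by
  have hδ := latticeSpacing_pos ha
  obtain ⟨m, hm, rfl⟩ := mem_latticeBlock.1 hx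
  rw [one_mul]
  set x := latticePoint a m with hxdef
  have hm0 : (0 : ℤ) < m := lt_of_lt_of_le (by positivity) hm.1
  have hx0 : 0 < x := mul_pos hδ (by exact_mod_cast hm0)
  have hxle : x ≤ 2 * Real.pi / a * 2 ^ (k + 1) :=
    mul_le_mul_of_nonneg_left (by exact_mod_cast hm.2.le) hδ.le
  have hneg : ∀ t ∈ latticeBlock a (-1) k, t < 0 ∧ -(2 * Real.pi / a * 2 ^ (k + 1)) ≤ t := by
    intro t ht
    obtain ⟨n, hn, rfl⟩ := mem_latticeBlock.1 ht
    have hn0 : (0 : ℤ) < n := lt_of_lt_of_le (by positivity) hn.1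
    have h1 : 0 < 2 * Real.pi / a * (n : ℝ) := mul_pos hδ (by exact_mod_cast hn0)
    have h2 : 2 * Real.pi / a * (n : ℝ) ≤ 2 * Real.pi / a * 2 ^ (k + 1) :=
      mul_le_mul_of_nonneg_left (by exact_mod_cast hn.2.le) hδ.le
    simp only [latticePoint, Int.cast_mul, Int.cast_neg, Int.cast_one]
    constructor <;> linarith
  have hint : ∫ t in {x}ᶜ, (stepFun x - stepFun t) / ((x : ℂ) - (t : ℂ)) * f t ∂latticeMeasure a
      = ((∫ t in (latticeBlock a (-1) k : Set ℝ), (x - t)⁻¹ ∂latticeMeasure a : ℝ) : ℂ) := by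
    rw [← integral_complex_ofReal, ← integral_indicator (Finset.measurableSet _),
      ← integral_indicator (measurableSet_singleton x).compl]
    refine integral_congr_ae (hf.mono fun t ht => ?_)
    by_cases htb : t ∈ (latticeBlock a (-1) k : Set ℝ)
    · have ht0 := (hneg t htb).1
      have : t ∈ ({x}ᶜ : Set ℝ) := (ht0.trans hx0).ne
      simp only [Set.indicator_of_mem this, Set.indicator_of_mem htb, ht, stepFun_of_neg ht0,
        stepFun_of_nonneg hx0.le]
      push_cast
      simp
    · rw [Set.indicator_of_notMem htb] at ht ⊢
      simp [Set.indicator_apply, ht]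
  -- The block has measure `2^k · 2π/a`, and the integrand is at least `(2^(k+2) · 2π/a)⁻¹` on it.
  have hlow : (1 : ℝ) / 4 ≤ ∫ t in (latticeBlock a (-1) k : Set ℝ), (x - t)⁻¹ ∂latticeMeasure a := by
    have hfin := latticeMeasure_latticeBlock_ne_top ha (by norm_num : (-1 : ℤ) ≠ 0) k
    have hconst : ∫ t in (latticeBlock a (-1) k : Set ℝ),
        (2 * Real.pi / a * 2 ^ (k + 2))⁻¹ ∂latticeMeasure a = 1 / 4 := by
      rw [setIntegral_const, Measure.real, latticeMeasure_latticeBlock ha (by norm_num),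
        ENNReal.toReal_ofReal (by positivity), smul_eq_mul, pow_add]
      field_simp
      norm_num
    rw [← hconst]
    refine setIntegral_mono_on (integrableOn_const hfin) ?_ (Finset.measurableSet _) fun t ht => ?_
    · refine Measure.integrableOn_of_bounded (M := x⁻¹) hfin (by fun_prop) ?_
      refine (ae_restrict_mem (Finset.measurableSet _)).mono fun t ht => ?_
      have := (hneg t ht).1
      rw [Real.norm_of_nonneg (inv_nonneg.2 (by linarith))]
      exact inv_anti₀ hx0 (by linarith)
    · obtain ⟨h1, h2⟩ := hneg t ht
      refine inv_anti₀ (by linarith) ?_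
      rw [show k + 2 = (k + 1) + 1 by ring, pow_succ (2 : ℝ) (k + 1)]
      linarith
  rw [commutatorIntegral, hint, norm_mul, Complex.norm_of_nonneg (by linarith), norm_div, norm_one,
    Complex.norm_of_nonneg Real.pi_pos.le]
  calc 1 / (4 * Real.pi) = 1 / Real.pi * (1 / 4) := by ring
    _ ≤ _ := mul_le_mul_of_nonneg_left hlow (by positivity)

lemma not_commutatorMemSchatten_stepFun {p a : ℝ} (hp : 0 ≤ p) (ha : 0 < a) :
    ¬ CommutatorMemSchatten p a stepFun := by
  rintro ⟨T, hT, hS⟩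
  have hδ := latticeSpacing_pos ha
  have hn : (-1 : ℤ) ≠ 0 := by norm_num
  let u : ℕ → LatticeL2 a := fun k => blockIndicator ha hn k 1
  have hu0 : ∀ k, 0 < ‖u k‖ := fun k => by
    rw [norm_blockIndicator]
    simp only [norm_one, one_mul]
    positivity
  have hTu : ∀ k, 1 / (4 * Real.pi) * ‖u k‖ ≤ ‖T (u k)‖ := by
    intro k
    have hcoe := blockIndicator_coeFn ha hn k 1
    have h1 : ‖blockIndicator ha one_ne_zero k ((1 / (4 * Real.pi) : ℝ) : ℂ)‖ ≤ ‖T (u k)‖ := by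
      refine Lp.norm_le_norm_of_ae_le ?_
      have hcomm := hT (u k) ⟨latticeBlock a (-1) k, hcoe.mono fun x hx hxs => by
        rw [hx, Set.indicator_of_notMem (by simpa using hxs)]⟩
      filter_upwards [hcomm, blockIndicator_coeFn ha one_ne_zero k ((1 / (4 * Real.pi) : ℝ) : ℂ)]
        with x hx hx'
      rw [hx, hx']
      by_cases hxb : x ∈ (latticeBlock a 1 k : Set ℝ)
      · rw [Set.indicator_of_mem hxb, Complex.norm_of_nonneg (by positivity)]
        exact le_norm_commutatorIntegral_block ha hxb hcoe
      · rw [Set.indicator_of_notMem hxb, norm_zero]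
        exact norm_nonneg _
    rw [norm_blockIndicator, Complex.norm_of_nonneg (by positivity)] at h1
    rwa [norm_blockIndicator, norm_one, one_mul]
  have he : Orthonormal ℂ fun k => ((‖u k‖⁻¹ : ℝ) : ℂ) • u k := by
    refine ⟨fun k => ?_, fun k l hkl => ?_⟩
    · rw [norm_smul, Complex.norm_of_nonneg (inv_nonneg.2 (norm_nonneg _)),
        inv_mul_cancel₀ (hu0 k).ne']
    · have h : inner ℂ (u k) (u l) = 0 := by
        have hd : (latticeBlock a (-1) k : Set ℝ) ∩ latticeBlock a (-1) l = ∅ :=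
          (Finset.disjoint_coe.2 (disjoint_latticeBlock ha hn hkl)).inter_eq
        simp only [u, blockIndicator]
        rw [L2.inner_indicatorConstLp_indicatorConstLp _ _
          (latticeMeasure_latticeBlock_ne_top ha hn k)
          (latticeMeasure_latticeBlock_ne_top ha hn l), hd]
        simp
      simp only [inner_smul_left, inner_smul_right, h, mul_zero]
  refine not_memSchatten_of_orthonormal he (c := 1 / (4 * Real.pi)) (by positivity) (fun k => ?_) hp hS
  rw [map_smul, norm_smul, Complex.norm_of_nonneg (inv_nonneg.2 (norm_nonneg _)), ← div_eq_inv_mul,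
    le_div_iff₀ (hu0 k)]
  exact hTu k

theorem propositionp3 (p a : ℝ) (hp0 : 0 < p) (hp1 : p < 1) (ha : 0 < a) :
    (∃ ψ : ℝ → ℂ, MemOscBesov p a ψ ∧ BoundedOnLattice a ψ ∧
      (∃ T : LatticeL2 a →L[ℂ] LatticeL2 a, IsCommutatorOperator a ψ T) ∧
      ¬ CommutatorMemSchatten p a ψ) ∧
    ¬ ∀ ψ : ℝ → ℂ, BoundedOnLattice a ψ →
      (CommutatorMemSchatten p a ψ ↔ MemOscBesov p a ψ) := by
  have hB := memOscBesov_stepFun hp0 ha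
  have hb : BoundedOnLattice a stepFun := ⟨1, fun x _ => norm_stepFun_le_one x⟩
  have hS := not_commutatorMemSchatten_stepFun hp0.le ha
  exact ⟨⟨stepFun, hB, hb, exists_isCommutatorOperator_stepFun ha, hS⟩,
    fun h => hS ((h stepFun hb).2 hB)⟩
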